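/- Let $q$ be a prime power, $m\ge 3$, $n\ge 1$ and $1\le I<J<n$ integers, $K:=J-I$, and let $\alpha_1,\dots,\alpha_m\in\mathbb{F}_{q^n}^*$, with the indices of the $\alpha_i$ and of the $x_i$ read modulo $m$ in $\{1,\dots,m\}$. Define the $\mathbb{F}_q$-subspace $$U_{\mathbf A}^{I,J}:=\{(x_1,\dots,x_m,f_1(\underline x),\dots,f_m(\underline x)) : x_1,\dots,x_m\in\mathbb{F}_{q^n}\}\subseteq \mathbb{F}_{q^n}^{2m},\qquad f_i(\underline x):=x_i^{q^I}+\alpha_{i+1}x_{i+1}^{q^J},$$ and put $\Pi_i:=\alpha_i^{q^{(m-1)K}}\alpha_{i-1}^{q^{(m-2)K}}\cdots\alpha_{i+2}^{q^K}\alpha_{i+1}$ (again with indices modulo $m$). Suppose that $n\ge 2J+1$ and that there is $\overline\delta\in\{1,\dots,m-1\}$ such that $\Pi_{\overline\delta+2}/\Pi_2$ is not a $(q^{mK}-1)$-th power in $\mathbb{F}_{q^n}$. Then $U_{\mathbf A}^{I,J}$, which has $\mathbb{F}_q$-dimension $mn$, is a (linear) cutting blocking set: it spans $\mathbb{F}_{q^n}^{2m}$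 over $\mathbb{F}_{q^n}$, and $\langle U_{\mathbf A}^{I,J}\cap H\rangle_{\mathbb{F}_{q^n}}=H$ for every $\mathbb{F}_{q^n}$-hyperplane $H$ of $\mathbb{F}_{q^n}^{2m}$. Moreover, the rank-metric code $\mathcal C\subseteq\mathbb{F}_{q^n}^{mn}$ associated with $U_{\mathbf A}^{I,J}$, that is, the $\mathbb{F}_{q^n}$-row space of a $2m\times mn$ matrix whose columns form any $\mathbb{F}_q$-basis of $U_{\mathbf A}^{I,J}$, is minimal: if $c,c'\in\mathcal C$ and the rank support of $c'$ is contained in the rank support of $c$, then $c'=a c$ for some $a\in\mathbb{F}_{q^n}$. Here the rank support of $c\in\mathbb{F}_{q^n}^{mn}$ is the $\mathbb{F}_q$-subspace of $\mathbb{F}_q^{mn}$ spanned by the columns of the $mn\times n$ matrix over $\mathbb{F}_q$ whose rows are the coordinate vectors of the entries of $c$ with respect to an $\mathbb{F}_q$-basis of $\mathbb{F}_{q^n}$. -/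

import Mathlib

/-- The set `{(x₁, …, x_m, f₁(x), …, f_m(x)) : x₁, …, x_m ∈ 𝔽_{qⁿ}}` with
`f_i(x) = x_i ^ (q ^ I) + α_{i+1} x_{i+1} ^ (q ^ J)` (indices modulo `m`; in particular
`f_m(x) = x_m ^ (q ^ I) + α₁ x₁ ^ (q ^ J)`), as an `𝔽_q`-subspace of `V(2m, qⁿ)`.
Here `𝔽_q = F`, `𝔽_{qⁿ} = L`, and an index `i ∈ {1, …, m}` is represented by its class in `ZMod m`.
The first `m` coordinates are the left summand of `ZMod m ⊕ ZMod m`. -/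
def cyclicSystem (F : Type*) {L : Type*} [Field F] [Finite F] [Field L] [Algebra F L]
    {m : ℕ} (α : ZMod m → L) (I J : ℕ) : Submodule F (ZMod m ⊕ ZMod m → L) where
  carrier := Set.range fun x : ZMod m → L =>
    Sum.elim x fun i => x i ^ (Nat.card F ^ I) + α (i + 1) * x (i + 1) ^ (Nat.card F ^ J)
  zero_mem' := ⟨0, by
    ext (i | i) <;> simp [Nat.card_pos.ne']⟩
  add_mem' := by
    letI := Fintype.ofFinite F
    have hadd : ∀ (k : ℕ) (a b : L),
        (a + b) ^ (Nat.card F ^ k) = a ^ (Nat.card F ^ k) + b ^ (Nat.card F ^ k) := by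
      intro k a b
      obtain ⟨p, hp⟩ := CharP.exists F
      obtain ⟨e, hpp, he⟩ := FiniteField.card F p
      have : Fact p.Prime := ⟨hpp⟩
      have : CharP L p := charP_of_injective_algebraMap (algebraMap F L).injective p
      rw [Nat.card_eq_fintype_card, he, ← pow_mul]
      exact add_pow_char_pow a b p _
    rintro _ _ ⟨x, rfl⟩ ⟨y, rfl⟩
    refine ⟨x + y, ?_⟩
    ext (i | i)
    · simp
    · simp only [Sum.elim_inr, Pi.add_apply, hadd]
      ring
  smul_mem' := by
    letI := Fintype.ofFinite F
    rintro c _ ⟨x, rfl⟩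
    refine ⟨c • x, ?_⟩
    ext (i | i)
    · simp
    · simp only [Sum.elim_inr, Pi.smul_apply, smul_pow, Nat.card_eq_fintype_card,
        FiniteField.pow_card_pow, smul_add, mul_smul_comm]

/-- `Π_i = α_i ^ (q ^ ((m-1)K)) · α_{i-1} ^ (q ^ ((m-2)K)) ⋯ α_{i+2} ^ (q ^ K) · α_{i+1}`,
indices modulo `m`. -/
def cyclicProd {L : Type*} [Field L] {m : ℕ} (q K : ℕ) (α : ZMod m → L) (i : ZMod m) : L :=
  ∏ k ∈ Finset.range m, α (i - (k : ZMod m)) ^ (q ^ ((m - 1 - k) * K))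

/-- An `𝔽_q`-subspace `U` of the `𝔽_{qⁿ}`-space `V` is a (linear) cutting blocking set if it spans
`V` over `𝔽_{qⁿ}` and `⟨U ∩ H⟩ = H` for every `𝔽_{qⁿ}`-hyperplane `H` of `V`. -/
def IsLinearCutting {F L V : Type*} [Field F] [Field L] [Algebra F L] [AddCommGroup V]
    [Module F V] [Module L V] [IsScalarTower F L V] (U : Submodule F V) : Prop :=
  Submodule.span L (U : Set V) = ⊤ ∧
    ∀ H : Submodule L V, Module.finrank L H + 1 = Module.finrank L V →
      Submodule.span L ((U : Set V) ∩ (H : Set V)) = H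

/-- The code associated with an `𝔽_q`-subspace `U` of `𝔽_{qⁿ}^κ` and an ordered `𝔽_q`-basis of `U`:
the `𝔽_{qⁿ}`-row space of the generator matrix whose columns are the basis vectors. -/
def associatedCode {F L κ : Type*} [Field F] [Field L] [Algebra F L] {N : ℕ}
    {U : Submodule F (κ → L)} (B : Module.Basis (Fin N) F U) : Submodule L (Fin N → L) :=
  Submodule.span L (Set.range fun i : κ => fun j : Fin N => (B j : κ → L) i)

/-- The rank support of `v ∈ 𝔽_{qⁿ}^N`: the `𝔽_q`-subspace
`{(φ v₁, …, φ v_N) : φ ∈ Hom_{𝔽_q}(𝔽_{qⁿ}, 𝔽_q)}` of `𝔽_q^N`. It is the column space of the matrix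
that expands the entries of `v` over an arbitrary `𝔽_q`-basis of `𝔽_{qⁿ}`, see
`rankSupport_eq_span`. -/
def rankSupport (F : Type*) {L : Type*} [Field F] [Field L] [Algebra F L] {N : ℕ}
    (v : Fin N → L) : Submodule F (Fin N → F) :=
  LinearMap.range (LinearMap.pi fun j => LinearMap.applyₗ (v j) :
    Module.Dual F L →ₗ[F] (Fin N → F))

theorem rankSupport_eq_span {F L : Type*} [Field F] [Field L] [Algebra F L] {N n : ℕ}
    (γ : Module.Basis (Fin n) F L) (v : Fin N → L) :
    rankSupport F v = Submodule.span F (Set.range fun k : Fin n => fun j => γ.repr (v j) k) := by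
  rw [rankSupport, LinearMap.range_eq_map, ← γ.dualBasis.span_eq, Submodule.map_span,
    ← Set.range_comp]
  congr 2
  ext k j
  simp

/-- A rank-metric code is minimal if all its codewords are: whenever the rank support of a codeword
`c'` is contained in that of a codeword `c`, then `c'` is an `𝔽_{qⁿ}`-multiple of `c`. -/
def IsMinimalRankCode (F : Type*) {L : Type*} [Field F] [Field L] [Algebra F L] {N : ℕ}
    (C : Submodule L (Fin N → L)) : Prop :=
  ∀ c ∈ C, ∀ c' ∈ C, rankSupport F c' ≤ rankSupport F c → ∃ a : L, c' = a • c

/-! Cutting and minimality both follow from one statement: if a linear form `ℓ'` vanishes on `U ∩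
ker ℓ`, then `ℓ'` is a multiple of `ℓ`. Otherwise `ℓ' = ψ ∘ ℓ` on `U` for some `F`-linear `ψ : L →
L`. With `u` the trace adjoint of `ψ` and `v = -id`, the trace of `u(s) ℓ(w) + v(s) ℓ'(w)` vanishes
for all `s` and all `w ∈ U`. Testing on one coordinate `x_i` at a time and moving Frobenius powers
across the trace gives a cyclic system in `u`, `v`, whose coefficients `a, b` and `a', b'` are those
of `ℓ` and `ℓ'` (`false_of_frobenius_system`).

The contradiction depends on the rank of the columns `(a, a')` of the top power `q^J`. In rank 2,
`u^(q^J)` and `v^(q^J)` reduce to lower powers, and a Frobenius-stable separating space of dimension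
at most `2J` forces `n ≤ 2J` (`finrank_le_of_separating`). In rank 0 the system is a recursion
`y_i^(q^K) = -α_i y_{i-1}`; going once around the cycle would make every `Π_i / Π_j` a `(q^(mK) -
1)`-th power unless `y = 0`. In rank 1 a change of variables leaves only `u` in the top power; then
either the dimension bound or the recursion argument applies, or `v` is a polynomial in `u` and
comparing coefficients finishes. -/

/-! ### Frobenius powers and a dimension bound for Frobenius-stable spaces. -/

section FrobeniusPowers

variable (F : Type*) {L : Type*} [Field F] [Finite F] [Field L] [Finite L] [Algebra F L]

/-- The automorphism `x ↦ x ^ (q ^ k)` of `L` over `F`, where `q` is the order of `F`. -/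
noncomputable def frobPow (k : ℕ) : L ≃ₐ[F] L :=
  letI := Fintype.ofFinite F
  FiniteField.frobeniusAlgEquivOfAlgebraic F L ^ k

theorem frobPow_apply (k : ℕ) (x : L) : frobPow F k x = x ^ (Nat.card F ^ k) := by
  let _ := Fintype.ofFinite F
  rw [frobPow, AlgEquiv.coe_pow, FiniteField.coe_frobeniusAlgEquivOfAlgebraic_iterate,
    Nat.card_eq_fintype_card]

@[simp]
theorem frobPow_zero (x : L) : frobPow F 0 x = x := by simp [frobPow_apply]

theorem frobPow_frobPow (j k : ℕ) (x : L) :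
    frobPow F j (frobPow F k x) = frobPow F (j + k) x := by
  simp only [frobPow_apply, ← pow_mul, ← pow_add, add_comm]

theorem exists_eq_frobPow (g : L ≃ₐ[F] L) : ∃ k, g = frobPow F k := by
  let _ := Fintype.ofFinite F
  obtain ⟨k, hk⟩ := (FiniteField.bijective_frobeniusAlgEquivOfAlgebraic_pow F L).2 g
  exact ⟨k, hk.symm⟩

theorem trace_frobPow (k : ℕ) (x : L) :
    Algebra.trace F L (frobPow F k x) = Algebra.trace F L x :=
  Algebra.trace_eq_of_algEquiv _ _

/-- The powers `x ^ (q ^ j)` with `j < [L : F]` are linearly independent functions over `L`. -/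
theorem coeff_eq_zero_of_sum_frobPow_eq_zero (c : ℕ → L)
    (h : ∀ x : L, ∑ j ∈ Finset.range (Module.finrank F L), c j * frobPow F j x = 0)
    {j : ℕ} (hj : j < Module.finrank F L) : c j = 0 := by
  let _ := Fintype.ofFinite F
  have hli := (linearIndependent_algHom_toLinearMap F L L).comp _
    (FiniteField.bijective_frobeniusAlgHom_pow F L).1
  rw [Fintype.linearIndependent_iff] at hli
  refine hli (fun j => c j) ?_ ⟨j, hj⟩
  ext x
  have := h x
  rw [Finset.sum_range] at this
  simpa [frobPow_apply, FiniteField.coe_frobeniusAlgHom, AlgHom.coe_pow, pow_iterate] using this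

/-- An `L`-space of `F`-linear functions on `L` that separates points and is stable under
the Frobenius automorphism has dimension at least `[L : F]`. -/
theorem finrank_le_of_separating (P : Submodule L (L →ₗ[F] L))
    (hstable : ∀ p ∈ P, (frobPow F 1).toLinearMap ∘ₗ p ∈ P)
    (hsep : ∀ s, (∀ p ∈ P, p s = 0) → s = 0) :
    Module.finrank F L ≤ Module.finrank L P := by
  have hpow : ∀ k, ∀ p ∈ P, (frobPow F k).toLinearMap ∘ₗ p ∈ P := by
    intro k
    induction k with
    | zero =>
      intro p hp
      convert hp
      ext
      simp
    | succ k ih =>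
      intro p hp
      convert hstable _ (ih p hp) using 1
      ext
      simp [frobPow_frobPow, add_comm]
  by_contra! hlt
  let e := Module.finBasis F L
  let ev : (Fin (Module.finrank F L) → L) →ₗ[L] Module.Dual L P :=
    LinearMap.mk₂ L (fun c p => ∑ k, c k * (p : L →ₗ[F] L) (e k))
      (by intros; simp [add_mul, Finset.sum_add_distrib])
      (by intros; simp [Finset.mul_sum, mul_assoc])
      (by intros; simp [mul_add, Finset.sum_add_distrib])
      (by intros; simp [Finset.mul_sum, mul_left_comm])
  have hker : LinearMap.ker ev ≠ ⊥ := LinearMap.ker_ne_bot_of_finrank_lt (by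
    rw [Module.finrank_fin_fun]
    exact (Subspace.dual_finrank_eq (K := L) (V := P)).trans_lt hlt)
  obtain ⟨c, hc, hc0⟩ := Submodule.exists_mem_ne_zero_of_ne_bot hker
  obtain ⟨k₀, hk₀⟩ := Function.ne_iff.1 hc0
  have hc : ∀ p ∈ P, ∑ k, c k * p (e k) = 0 := fun p hp =>
    LinearMap.congr_fun (LinearMap.mem_ker.1 hc) ⟨p, hp⟩
  -- Stability allows every automorphism to be applied to the coefficients `c k`. Summing over the
  -- Galois group turns them into traces in `F`, which move inside `p`; the factor `t / c k₀` makes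
  -- the `k₀`-th trace equal to 1.
  obtain ⟨t, ht⟩ := Algebra.trace_surjective F L 1
  have hz : ∑ k, Algebra.trace F L (t / c k₀ * c k) • e k = 0 := by
    refine hsep _ fun p hp => ?_
    rw [map_sum]
    simp only [p.map_smul]
    simp only [Algebra.smul_def, trace_eq_sum_automorphisms, Finset.sum_mul]
    rw [Finset.sum_comm]
    refine Finset.sum_eq_zero fun g _ => ?_
    obtain ⟨k, hk⟩ := exists_eq_frobPow F g.symm
    have h := congr_arg g (congr_arg (t / c k₀ * ·) (hc _ (hpow k p hp)))
    rw [← hk] at h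
    simpa [Finset.mul_sum, mul_assoc] using h
  have := Fintype.linearIndependent_iff.1 e.linearIndependent _ hz k₀
  rw [div_mul_cancel₀ _ hk₀, ht] at this
  exact one_ne_zero this

variable {F}

/-- The `L`-space spanned by the functions `u ^ (q ^ j)`, `j < d₁`, and `v ^ (q ^ j)`, `j < d₂`. -/
noncomputable def frobSpan (u v : L →ₗ[F] L) (d₁ d₂ : ℕ) : Submodule L (L →ₗ[F] L) :=
  Submodule.span L (Set.range (Sum.elim
    (fun j : Fin d₁ => (frobPow F (j : ℕ)).toLinearMap ∘ₗ u)
    (fun j : Fin d₂ => (frobPow F (j : ℕ)).toLinearMap ∘ₗ v)))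

theorem left_mem_frobSpan (u v : L →ₗ[F] L) {d₁ : ℕ} (d₂ : ℕ) {j : ℕ} (hj : j < d₁) :
    (frobPow F j).toLinearMap ∘ₗ u ∈ frobSpan u v d₁ d₂ :=
  Submodule.subset_span ⟨.inl ⟨j, hj⟩, rfl⟩

theorem right_mem_frobSpan (u v : L →ₗ[F] L) (d₁ : ℕ) {d₂ : ℕ} {j : ℕ} (hj : j < d₂) :
    (frobPow F j).toLinearMap ∘ₗ v ∈ frobSpan u v d₁ d₂ :=
  Submodule.subset_span ⟨.inr ⟨j, hj⟩, rfl⟩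

/-- If two jointly injective linear functions satisfy a system of equations expressing
`u ^ (q ^ d₁)` and `v ^ (q ^ d₂)` through lower Frobenius powers, then `[L : F] ≤ d₁ + d₂`. -/
theorem finrank_le_add_of_mem_frobSpan {u v : L →ₗ[F] L}
    (huv : ∀ s, u s = 0 → v s = 0 → s = 0) {d₁ d₂ : ℕ}
    (hu : (frobPow F d₁).toLinearMap ∘ₗ u ∈ frobSpan u v d₁ d₂)
    (hv : (frobPow F d₂).toLinearMap ∘ₗ v ∈ frobSpan u v d₁ d₂) :
    Module.finrank F L ≤ d₁ + d₂ := by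
  have hle : ∀ j ≤ d₁, (frobPow F j).toLinearMap ∘ₗ u ∈ frobSpan u v d₁ d₂ := fun j hj =>
    hj.lt_or_eq.elim (fun h => left_mem_frobSpan u v d₂ h) (fun h => h ▸ hu)
  have hre : ∀ j ≤ d₂, (frobPow F j).toLinearMap ∘ₗ v ∈ frobSpan u v d₁ d₂ := fun j hj =>
    hj.lt_or_eq.elim (fun h => right_mem_frobSpan u v d₁ h) (fun h => h ▸ hv)
  have hcomp : ∀ (j : ℕ) (w : L →ₗ[F] L), (frobPow F 1).toLinearMap ∘ₗ
      ((frobPow F j).toLinearMap ∘ₗ w) = (frobPow F (j + 1)).toLinearMap ∘ₗ w := by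
    intro j w
    ext
    simp [frobPow_frobPow, add_comm]
  refine (finrank_le_of_separating F (frobSpan u v d₁ d₂) (fun p hp => ?_) fun s hs => ?_).trans ?_
  · induction hp using Submodule.span_induction with
    | mem p hp =>
      obtain ⟨j | j, rfl⟩ := hp
      · simpa only [Sum.elim_inl, hcomp] using hle _ j.2
      · simpa only [Sum.elim_inr, hcomp] using hre _ j.2
    | zero => simp
    | add p p' _ _ h h' =>
      rw [LinearMap.comp_add]
      exact add_mem h h'
    | smul c p _ h =>
      convert Submodule.smul_mem _ (frobPow F 1 c) h using 1
      ext
      simp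
  · exact huv s (by simpa using hs _ (hle 0 (Nat.zero_le _)))
      (by simpa using hs _ (hre 0 (Nat.zero_le _)))
  · refine (finrank_range_le_card _).trans ?_
    simp

end FrobeniusPowers

/-! ### The cyclic recursion. -/

section CyclicProduct

/-- Iterating a cyclic recursion `y_i ^ (q ^ K) = μ α_i y_{i-1}`. -/
theorem exists_pow_eq_mul_prod_mul {L : Type*} [Field L] {m : ℕ} {q K : ℕ} {α y : ZMod m → L}
    {μ : L} (hy : ∀ i, y i ^ (q ^ K) = μ * α i * y (i - 1)) (r : ℕ) :
    ∃ M : L, ∀ i, y i ^ (q ^ (r * K)) =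
      M * (∏ k ∈ Finset.range r, α (i - (k : ZMod m)) ^ (q ^ ((r - 1 - k) * K))) *
        y (i - (r : ZMod m)) := by
  induction r with
  | zero => exact ⟨1, by simp⟩
  | succ r ih =>
    obtain ⟨M, hM⟩ := ih
    refine ⟨M ^ (q ^ K) * μ, fun i => ?_⟩
    rw [add_mul, one_mul, pow_add, pow_mul, hM, mul_pow, mul_pow, hy, Finset.prod_range_succ,
      ← Finset.prod_pow]
    have : ∀ k ∈ Finset.range r, (α (i - (k : ZMod m)) ^ (q ^ ((r - 1 - k) * K))) ^ (q ^ K) =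
        α (i - (k : ZMod m)) ^ (q ^ ((r + 1 - 1 - k) * K)) := by
      intro k hk
      have hk : r + 1 - 1 - k = (r - 1 - k) + 1 := by
        have := Finset.mem_range.1 hk
        omega
      rw [hk, add_mul, one_mul, pow_add q, pow_mul (α _)]
    rw [Finset.prod_congr rfl this, Nat.cast_succ, sub_sub]
    simp
    ring

/-- If a quotient of two cyclic products is not a `(q ^ (mK) - 1)`-th power, then the cyclic
recursion `y_i ^ (q ^ K) = μ α_i y_{i-1}` has only the zero solution. -/
theorem eq_zero_of_cyclic_recursion {L : Type*} [Field L] {m : ℕ} [NeZero m] {q K : ℕ}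
    (hq : 0 < q) {α y : ZMod m → L} {μ : L} {i₁ i₂ : ZMod m}
    (hpow : ¬ ∃ β : L, β ^ (q ^ (m * K) - 1) = cyclicProd q K α i₁ / cyclicProd q K α i₂)
    (hy : ∀ i, y i ^ (q ^ K) = μ * α i * y (i - 1)) : y = 0 := by
  by_contra hne
  -- A single zero propagates around the cycle through the recursion.
  have hy0 : ∀ i, y i ≠ 0 := by
    intro i hi
    have hall : ∀ k : ℕ, y (i + (k : ZMod m)) = 0 := by
      intro k
      induction k with
      | zero => simpa using hi
      | succ k ih =>
        have h := hy (i + (k : ZMod m) + 1)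
        rw [add_sub_cancel_right, ih, mul_zero] at h
        rw [Nat.cast_succ, ← add_assoc]
        exact eq_zero_of_pow_eq_zero h
    refine hne (funext fun j => ?_)
    have := hall (j - i).val
    rwa [ZMod.natCast_zmod_val, add_sub_cancel] at this
  obtain ⟨M, hM⟩ := exists_pow_eq_mul_prod_mul hy m
  have hQ : q ^ (m * K) ≠ 0 := (pow_pos hq _).ne'
  have hM' : ∀ i, y i ^ (q ^ (m * K) - 1) = M * cyclicProd q K α i := by
    intro i
    refine mul_right_cancel₀ (hy0 i) ?_
    rw [pow_sub_one_mul hQ, hM, ZMod.natCast_self, sub_zero]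
    rfl
  have hM0 : M ≠ 0 := by
    rintro rfl
    have := hM' i₁
    rw [zero_mul] at this
    exact hy0 _ (eq_zero_of_pow_eq_zero this)
  exact hpow ⟨y i₁ / y i₂, by rw [div_pow, hM', hM', mul_div_mul_left _ _ hM0]⟩

end CyclicProduct

/-! ### Two-by-two minors. -/

section LinearAlgebra

variable {L : Type*} [Field L]

theorem mem_and_mem_of_det_ne_zero {M : Type*} [AddCommGroup M] [Module L M]
    {P : Submodule L M} {x y : M} {p p' r r' : L} (hdet : p * r' ≠ r * p')
    (h : p • x + p' • y ∈ P) (h' : r • x + r' • y ∈ P) : x ∈ P ∧ y ∈ P := by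
  have hD : p * r' - r * p' ≠ 0 := sub_ne_zero.2 hdet
  constructor
  · refine (P.smul_mem_iff hD).1 ?_
    convert sub_mem (P.smul_mem r' h) (P.smul_mem p' h') using 1
    module
  · refine (P.smul_mem_iff hD).1 ?_
    convert sub_mem (P.smul_mem p h') (P.smul_mem r h) using 1
    module

/-- If all `2 × 2` minors of two functions vanish, the second is a multiple of the first
unless the first is zero. -/
theorem exists_eq_mul_of_minors_eq {ι : Type*} {a b : ι → L} (ha : a ≠ 0)
    (h : ∀ i j, a i * b j = a j * b i) : ∃ c, ∀ i, b i = c * a i := by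
  obtain ⟨i₀, hi₀⟩ := Function.ne_iff.1 ha
  rw [Pi.zero_apply] at hi₀
  refine ⟨b i₀ / a i₀, fun i => ?_⟩
  field_simp
  linear_combination h i₀ i

end LinearAlgebra

/-! ### The Frobenius system, by the rank of its top coefficients. -/

section FrobeniusSystem

variable {F L : Type*} [Field F] [Finite F] [Field L] [Finite L] [Algebra F L]

/-- All exponents are below `[L : F]`, so coefficients can be compared. Only `J` and `2 * K` can
coincide, which accounts for the disjunction. -/
theorem coeff_eq_zero_of_four_terms {J K : ℕ} (hK : 1 ≤ K) (hKJ : K < J)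
    (hn : 2 * J + 1 ≤ Module.finrank F L) {e₀ e₁ e₂ e₃ : L}
    (h : ∀ x : L, e₀ * x + e₁ * frobPow F K x + e₂ * frobPow F J x +
      e₃ * frobPow F (2 * K) x = 0) :
    e₀ = 0 ∧ e₁ = 0 ∧ (e₂ = 0 ∨ e₂ + e₃ = 0) := by
  have key := fun j => coeff_eq_zero_of_sum_frobPow_eq_zero F
    (fun j => (if j = 0 then e₀ else 0) + (if j = K then e₁ else 0) + (if j = J then e₂ else 0) +
      (if j = 2 * K then e₃ else 0)) (fun x => by
      simp only [add_mul, ite_mul, zero_mul, Finset.sum_add_distrib, Finset.sum_ite_eq',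
        Finset.mem_range]
      rw [if_pos (by omega), if_pos (by omega), if_pos (by omega), if_pos (by omega), frobPow_zero,
        h x]) (j := j)
  refine ⟨?_, ?_, ?_⟩
  · have := key 0 (by omega)
    simpa [show (0 : ℕ) ≠ K by omega, show (0 : ℕ) ≠ J by omega, show (0 : ℕ) ≠ 2 * K by omega]
      using this
  · have := key K (by omega)
    simpa [show K ≠ 0 by omega, show K ≠ J by omega, show K ≠ 2 * K by omega] using this
  · have := key J (by omega)
    by_cases hJ : J = 2 * K
    · right
      simpa [show J ≠ 0 by omega, show J ≠ K by omega, ← hJ] using this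
    · left
      simpa [show J ≠ 0 by omega, show J ≠ K by omega, hJ] using this

variable {m J K : ℕ} {α a a' b b' : ZMod m → L} {u v : L →ₗ[F] L}

/-- The case of a system of rank two in its top Frobenius power. -/
theorem false_of_frobenius_system_of_minor_ne (hKJ : K < J)
    (hn : 2 * J + 1 ≤ Module.finrank F L) (huv : ∀ s, u s = 0 → v s = 0 → s = 0)
    (hE : ∀ i s, frobPow F J (a i * u s + a' i * v s) + frobPow F K (b i * u s + b' i * v s) +
      α i * (b (i - 1) * u s + b' (i - 1) * v s) = 0)
    {i j : ZMod m} (hij : a i * a' j ≠ a j * a' i) : False := by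
  have hmem : ∀ i, frobPow F J (a i) • ((frobPow F J).toLinearMap ∘ₗ u) +
      frobPow F J (a' i) • ((frobPow F J).toLinearMap ∘ₗ v) ∈ frobSpan u v J J := by
    intro i
    have h := neg_mem (add_mem
      (add_mem
        (Submodule.smul_mem _ (frobPow F K (b i)) (left_mem_frobSpan u v J hKJ))
        (Submodule.smul_mem _ (frobPow F K (b' i)) (right_mem_frobSpan u v J hKJ)))
      (add_mem
        (Submodule.smul_mem _ (α i * b (i - 1)) (left_mem_frobSpan u v J (K.zero_le.trans_lt hKJ)))
        (Submodule.smul_mem _ (α i * b' (i - 1))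
          (right_mem_frobSpan u v J (K.zero_le.trans_lt hKJ)))))
    convert h using 1
    ext s
    have := hE i s
    simp only [map_add, map_mul] at this
    simp
    linear_combination this
  have hdet : frobPow F J (a i) * frobPow F J (a' j) ≠ frobPow F J (a j) * frobPow F J (a' i) := by
    rw [← map_mul, ← map_mul]
    exact (frobPow F J).injective.ne hij
  obtain ⟨hu, hv⟩ := mem_and_mem_of_det_ne_zero hdet (hmem i) (hmem j)
  have := finrank_le_add_of_mem_frobSpan huv hu hv
  omega

/-- The case where the top Frobenius power only involves one of the two functions. -/
theorem false_of_frobenius_system_of_right_eq_zero [NeZero m] (hα : ∀ i, α i ≠ 0) (hK : 1 ≤ K)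
    (hKJ : K < J) {i₁ i₂ : ZMod m}
    (hpow : ¬ ∃ β : L, β ^ (Nat.card F ^ (m * K) - 1) =
      cyclicProd (Nat.card F) K α i₁ / cyclicProd (Nat.card F) K α i₂)
    (hn : 2 * J + 1 ≤ Module.finrank F L) (huv : ∀ s, u s = 0 → v s = 0 → s = 0)
    (hE : ∀ i s, frobPow F J (a i * u s) + frobPow F K (b i * u s + b' i * v s) +
      α i * (b (i - 1) * u s + b' (i - 1) * v s) = 0)
    (ha : a ≠ 0) (hb' : b' ≠ 0) : False := by
  have hE' : ∀ i s, frobPow F J (a i) * frobPow F J (u s) + frobPow F K (b i) * frobPow F K (u s) +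
      frobPow F K (b' i) * frobPow F K (v s) +
      α i * (b (i - 1) * u s + b' (i - 1) * v s) = 0 := by
    intro i s
    have := hE i s
    simp only [map_add, map_mul] at this
    linear_combination this
  have hB' : (fun i => frobPow F K (b' i)) ≠ 0 := by
    obtain ⟨i, hi⟩ := Function.ne_iff.1 hb'
    exact Function.ne_iff.2 ⟨i, by simpa using hi⟩
  -- A nonzero minor lets `u^(q^J)` and `v^(q^K)` be solved for, giving `[L : F] ≤ J + K`. Otherwise
  -- the two columns are proportional and `l u^(q^J) + v^(q^K)` acts as a single unknown.
  by_cases hAB : ∀ i j, frobPow F K (b' i) * frobPow F J (a j) =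
    frobPow F K (b' j) * frobPow F J (a i)
  swap
  · push Not at hAB
    obtain ⟨i, j, hij⟩ := hAB
    have hmem : ∀ i, frobPow F J (a i) • ((frobPow F J).toLinearMap ∘ₗ u) +
        frobPow F K (b' i) • ((frobPow F K).toLinearMap ∘ₗ v) ∈ frobSpan u v J K := by
      intro i
      have h := neg_mem (add_mem
        (Submodule.smul_mem _ (frobPow F K (b i)) (left_mem_frobSpan u v K hKJ))
        (add_mem
          (Submodule.smul_mem _ (α i * b (i - 1))
            (left_mem_frobSpan u v K (K.zero_le.trans_lt hKJ)))
          (Submodule.smul_mem _ (α i * b' (i - 1)) (right_mem_frobSpan u v J hK))))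
      convert h using 1
      ext s
      simp
      linear_combination hE' i s
    obtain ⟨hu, hv⟩ := mem_and_mem_of_det_ne_zero (by rw [mul_comm, mul_comm (frobPow F J (a i))]
                                                      exact hij) (hmem j) (hmem i)
    have := finrank_le_add_of_mem_frobSpan huv hu hv
    omega
  obtain ⟨l, hl⟩ := exists_eq_mul_of_minors_eq hB' hAB
  have hl0 : l ≠ 0 := by
    rintro rfl
    refine ha (funext fun i => ?_)
    simpa using hl i
  -- If all these minors vanished, `b'` would satisfy the cyclic recursion and be zero.
  have hdet : ∃ i j, frobPow F K (b' i) * (α j * b' (j - 1)) ≠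
      frobPow F K (b' j) * (α i * b' (i - 1)) := by
    by_contra! h
    obtain ⟨c, hc⟩ := exists_eq_mul_of_minors_eq (b := fun i => α i * b' (i - 1)) hB' h
    have hc0 : c ≠ 0 := by
      rintro rfl
      refine hb' (funext fun i => ?_)
      simpa [hα] using hc (i + 1)
    refine hb' (eq_zero_of_cyclic_recursion Nat.card_pos hpow (μ := c⁻¹) fun i => ?_)
    rw [mul_assoc, hc i, inv_mul_cancel_left₀ hc0, frobPow_apply]
  obtain ⟨i, j, hij⟩ := hdet
  set D := frobPow F K (b' i) * (α j * b' (j - 1)) - frobPow F K (b' j) * (α i * b' (i - 1))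
    with hD
  have hD0 : D ≠ 0 := sub_ne_zero.2 hij
  have hE'' : ∀ i s, frobPow F K (b' i) * (l * frobPow F J (u s) + frobPow F K (v s)) +
      frobPow F K (b i) * frobPow F K (u s) + α i * (b (i - 1) * u s + b' (i - 1) * v s) = 0 := by
    intro i s
    have := hE' i s
    rw [hl i] at this
    linear_combination this
  -- Cramer's rule for equations `i` and `j`, in the unknowns `v` and `l u^(q^J) + v^(q^K)`.
  obtain ⟨c, d, hv⟩ : ∃ c d, ∀ s, v s = c * u s + d * frobPow F K (u s) := by
    refine ⟨(frobPow F K (b' j) * (α i * b (i - 1)) - frobPow F K (b' i) * (α j * b (j - 1))) / D,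
      (frobPow F K (b' j) * frobPow F K (b i) - frobPow F K (b' i) * frobPow F K (b j)) / D,
      fun s => ?_⟩
    field_simp
    rw [hD]
    linear_combination frobPow F K (b' i) * hE'' j s - frobPow F K (b' j) * hE'' i s
  obtain ⟨e, f, hz⟩ : ∃ e f, ∀ s, l * frobPow F J (u s) + frobPow F K (v s) =
      e * u s + f * frobPow F K (u s) := by
    refine ⟨(α i * b' (i - 1) * (α j * b (j - 1)) - α j * b' (j - 1) * (α i * b (i - 1))) / D,
      (α i * b' (i - 1) * frobPow F K (b j) - α j * b' (j - 1) * frobPow F K (b i)) / D,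
      fun s => ?_⟩
    field_simp
    rw [hD]
    linear_combination (α j * b' (j - 1)) * hE'' i s - (α i * b' (i - 1)) * hE'' j s
  have hinj : Function.Injective u := (injective_iff_map_eq_zero u).2 fun s hs =>
    huv s hs (by simp [hv, hs])
  have hsurj : Function.Surjective u := LinearMap.injective_iff_surjective.1 hinj
  -- Since `u` is onto, `u s` is a free variable. Substituting `v` into the second Cramer formula
  -- gives an identity with exponents `0, K, J, 2K`.
  obtain ⟨he, hf, hd⟩ := coeff_eq_zero_of_four_terms (e₀ := -e) (e₁ := frobPow F K c - f)
    (e₂ := l) (e₃ := frobPow F K d) hK hKJ hn (by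
      intro x
      obtain ⟨s, rfl⟩ := hsurj x
      have := hz s
      rw [hv, map_add, map_mul, map_mul, frobPow_frobPow, ← two_mul] at this
      linear_combination this)
  have hd0 : d ≠ 0 := by
    rintro rfl
    simp [hl0] at hd
  have hcoef : ∀ i, α i * (b (i - 1) + c * b' (i - 1)) = 0 ∧
      frobPow F K (b' i) * f + frobPow F K (b i) + α i * b' (i - 1) * d = 0 := by
    intro i
    obtain ⟨h0, h1, -⟩ := coeff_eq_zero_of_four_terms (e₀ := α i * (b (i - 1) + c * b' (i - 1)))
      (e₁ := frobPow F K (b' i) * f + frobPow F K (b i) + α i * b' (i - 1) * d)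
      (e₂ := 0) (e₃ := 0) hK hKJ hn (by
        intro x
        obtain ⟨s, rfl⟩ := hsurj x
        have := hE'' i s
        rw [hz, hv, neg_eq_zero.1 he] at this
        linear_combination this)
    exact ⟨h0, h1⟩
  have hbb : ∀ i, b i = - (c * b' i) := by
    intro i
    have := (hcoef (i + 1)).1
    rw [add_sub_cancel_right] at this
    exact eq_neg_of_add_eq_zero_left ((mul_eq_zero.1 this).resolve_left (hα _))
  refine hb' (funext fun i => ?_)
  have := (hcoef (i + 1)).2
  rw [hbb, map_neg, map_mul, sub_eq_zero.1 hf, add_sub_cancel_right] at this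
  have h0 : α (i + 1) * b' i * d = 0 := by linear_combination this
  simpa [hα, hd0] using h0

/-- The Frobenius system has no jointly injective solution. -/
theorem false_of_frobenius_system [NeZero m] (hα : ∀ i, α i ≠ 0) (hK : 1 ≤ K)
    (hKJ : K < J) {i₁ i₂ : ZMod m}
    (hpow : ¬ ∃ β : L, β ^ (Nat.card F ^ (m * K) - 1) =
      cyclicProd (Nat.card F) K α i₁ / cyclicProd (Nat.card F) K α i₂)
    (hn : 2 * J + 1 ≤ Module.finrank F L) (huv : ∀ s, u s = 0 → v s = 0 → s = 0)
    (hE : ∀ i s, frobPow F J (a i * u s + a' i * v s) + frobPow F K (b i * u s + b' i * v s) +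
      α i * (b (i - 1) * u s + b' (i - 1) * v s) = 0)
    (hind : ∀ s t : L, (∀ i, s * a i + t * a' i = 0) → (∀ i, s * b i + t * b' i = 0) →
      s = 0 ∧ t = 0) : False := by
  by_cases ha : a = 0
  · have hb : b ≠ 0 := by
      rintro rfl
      exact one_ne_zero (hind 1 0 (by simp [ha]) (by simp)).1
    subst ha
    by_cases ha' : a' = 0
    · subst ha'
      have hy : ∀ s i, b i * u s + b' i * v s = 0 := fun s => congr_fun
        (eq_zero_of_cyclic_recursion Nat.card_pos hpow (μ := -1) fun i => by
          rw [← frobPow_apply]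
          have := hE i s
          simp only [Pi.zero_apply, zero_mul, add_zero, map_zero, zero_add] at this
          linear_combination this)
      refine one_ne_zero (α := L) (huv 1 ?_ ?_)
      · exact (hind (u 1) (v 1) (by simp) fun i => by linear_combination hy 1 i).1
      · exact (hind (u 1) (v 1) (by simp) fun i => by linear_combination hy 1 i).2
    · refine false_of_frobenius_system_of_right_eq_zero (u := v) (v := u) hα hK hKJ hpow hn
        (fun s h h' => huv s h' h) (b := b') (b' := b) (fun i s => ?_) ha' hb
      have := hE i s
      rw [Pi.zero_apply, zero_mul, zero_add, add_comm (b i * u s), add_comm (b _ * u s)] at this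
      exact this
  · by_cases hdet : ∀ i j, a i * a' j = a j * a' i
    swap
    · push Not at hdet
      obtain ⟨i, j, hij⟩ := hdet
      exact false_of_frobenius_system_of_minor_ne hKJ hn huv hE hij
    obtain ⟨c, hc⟩ := exists_eq_mul_of_minors_eq ha hdet
    -- As `a' = c a`, the top term is `a (u + c v)`; rewriting in `u + c v` and `v` turns `b'` into
    -- `b' - c b`.
    refine false_of_frobenius_system_of_right_eq_zero (u := u + c • v) (v := v) (b := b)
      (b' := fun i => b' i - c * b i) hα hK hKJ hpow hn (fun s h h' => huv s ?_ h')
      (fun i s => ?_) ha ?_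
    · simpa [h'] using h
    · rw [← hE i s, hc i]
      simp only [LinearMap.add_apply, LinearMap.smul_apply, smul_eq_mul]
      congr 2
      · congr 1
        ring
      · congr 1
        ring
      · ring
    · intro h
      refine one_ne_zero (hind (-c) 1 (fun i => by rw [hc]; ring) fun i => ?_).2
      have : b' i - c * b i = 0 := congr_fun h i
      linear_combination this

end FrobeniusSystem

/-! ### Linear forms in coordinates. -/

section LinearForms

variable {L : Type*} [Field L]

theorem apply_single_eq_mul {ι : Type*} [DecidableEq ι] (ℓ : (ι → L) →ₗ[L] L) (i : ι) (t : L) :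
    ℓ (Pi.single i t) = ℓ (Pi.single i 1) * t := by
  rw [mul_comm, ← smul_eq_mul, ← map_smul, ← Pi.single_smul, smul_eq_mul, mul_one]

theorem eq_zero_of_apply_single_eq_zero {m : ℕ} [NeZero m] {ℓ : (ZMod m ⊕ ZMod m → L) →ₗ[L] L}
    (h : ∀ i, ℓ (Pi.single (.inl i) 1) = 0) (h' : ∀ i, ℓ (Pi.single (.inr i) 1) = 0) : ℓ = 0 := by
  refine LinearMap.pi_ext' fun i => LinearMap.ext_ring ?_
  obtain i | i := i
  · exact h i
  · exact h' i

end LinearForms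

/-! ### From linear forms on the cyclic system to the Frobenius system. -/

section CyclicSystem

variable {F L : Type*} [Field F] [Finite F] [Field L] [Finite L] [Algebra F L]

theorem exists_trace_adjoint (ψ : L →ₗ[F] L) :
    ∃ u : L →ₗ[F] L, ∀ s y, Algebra.trace F L (u s * y) = Algebra.trace F L (s * ψ y) := by
  refine ⟨((Algebra.traceForm F L).toDual (traceForm_nondegenerate F L)).symm.toLinearMap ∘ₗ
    LinearMap.lcomp F F ψ ∘ₗ Algebra.traceForm F L, fun s y => ?_⟩
  rw [← Algebra.traceForm_apply]
  simp [LinearMap.BilinForm.apply_toDual_symm_apply]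

theorem exists_comp_eq_of_ker_le_ker {K V W W' : Type*} [Field K] [AddCommGroup V] [Module K V]
    [AddCommGroup W] [Module K W] [AddCommGroup W'] [Module K W'] {f : V →ₗ[K] W} {g : V →ₗ[K] W'}
    (h : LinearMap.ker f ≤ LinearMap.ker g) : ∃ ψ : W →ₗ[K] W', ∀ x, ψ (f x) = g x := by
  obtain ⟨ψ, hψ⟩ := LinearMap.exists_extend
    ((LinearMap.ker f).liftQ g h ∘ₗ f.quotKerEquivRange.symm.toLinearMap)
  refine ⟨ψ, fun x => ?_⟩
  have := LinearMap.congr_fun hψ ⟨f x, x, rfl⟩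
  simp only [LinearMap.comp_apply, Submodule.subtype_apply, LinearEquiv.coe_coe] at this
  rw [this, show (⟨f x, x, rfl⟩ : LinearMap.range f) =
    f.quotKerEquivRange ((LinearMap.ker f).mkQ x) from rfl, LinearEquiv.symm_apply_apply]
  simp

variable {m : ℕ}

/-- The parametrization of `cyclicSystem` by its first `m` coordinates. -/
noncomputable def cyclicMap (F : Type*) {L : Type*} [Field F] [Finite F] [Field L] [Finite L]
    [Algebra F L] {m : ℕ} (α : ZMod m → L) (I J : ℕ) :
    (ZMod m → L) →ₗ[F] (ZMod m ⊕ ZMod m → L) where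
  toFun x := Sum.elim x fun i => frobPow F I (x i) + α (i + 1) * frobPow F J (x (i + 1))
  map_add' x y := by
    ext (i | i)
    · simp
    · simp
      ring
  map_smul' c x := by
    ext (i | i) <;> simp

theorem range_cyclicMap (α : ZMod m → L) (I J : ℕ) :
    LinearMap.range (cyclicMap F α I J) = cyclicSystem F α I J := by
  ext w
  refine exists_congr fun x => ?_
  simp [cyclicMap, frobPow_apply]

theorem cyclicMap_injective (α : ZMod m → L) (I J : ℕ) :
    Function.Injective (cyclicMap F α I J) := fun x y h => by
  ext i
  exact congr_fun h (.inl i)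

theorem cyclicMap_mem (α : ZMod m → L) (I J : ℕ) (x : ZMod m → L) :
    cyclicMap F α I J x ∈ cyclicSystem F α I J :=
  range_cyclicMap (F := F) α I J ▸ LinearMap.mem_range_self _ x

theorem finrank_cyclicSystem [NeZero m] (α : ZMod m → L) (I J : ℕ) :
    Module.finrank F (cyclicSystem F α I J) = m * Module.finrank F L := by
  rw [← range_cyclicMap, LinearMap.finrank_range_of_inj (cyclicMap_injective α I J)]
  simp [Module.finrank_pi_fintype, ZMod.card]

theorem cyclicMap_single (α : ZMod m → L) (I J : ℕ) (i : ZMod m) (t : L) :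
    cyclicMap F α I J (Pi.single i t) = Pi.single (.inl i) t +
      Pi.single (.inr i) (frobPow F I t) + Pi.single (.inr (i - 1)) (α i * frobPow F J t) := by
  ext (j | j)
  · simp [cyclicMap, Pi.single_apply]
  · simp only [cyclicMap, LinearMap.coe_mk, AddHom.coe_mk, Sum.elim_inr, Pi.single_apply,
      Pi.add_apply, reduceCtorEq, if_false, zero_add, Sum.inr.injEq, eq_sub_iff_add_eq]
    congr 1
    · split_ifs <;> simp
    · split_ifs with h
      · rw [h]
      · simp

theorem apply_cyclicMap_single (ℓ : (ZMod m ⊕ ZMod m → L) →ₗ[L] L) (α : ZMod m → L) (I J : ℕ)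
    (i : ZMod m) (t : L) :
    ℓ (cyclicMap F α I J (Pi.single i t)) = ℓ (Pi.single (.inl i) 1) * t +
      ℓ (Pi.single (.inr i) 1) * frobPow F I t +
      ℓ (Pi.single (.inr (i - 1)) 1) * (α i * frobPow F J t) := by
  rw [cyclicMap_single, map_add, map_add, apply_single_eq_mul, apply_single_eq_mul ℓ (.inr i),
    apply_single_eq_mul ℓ (.inr (i - 1))]

variable [NeZero m] {α : ZMod m → L} {I J : ℕ}

theorem eq_zero_of_vanishing_on_cyclicSystem (hI : 1 ≤ I) (hIJ : I < J)
    (hn : 2 * J + 1 ≤ Module.finrank F L) {ℓ : (ZMod m ⊕ ZMod m → L) →ₗ[L] L}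
    (h : ∀ w ∈ cyclicSystem F α I J, ℓ w = 0) : ℓ = 0 := by
  have key : ∀ i, ℓ (Pi.single (.inl i) 1) = 0 ∧ ℓ (Pi.single (.inr i) 1) = 0 := by
    intro i
    obtain ⟨h0, h1, -⟩ := coeff_eq_zero_of_four_terms (F := F) (e₀ := ℓ (Pi.single (.inl i) 1))
      (e₁ := ℓ (Pi.single (.inr i) 1)) (e₂ := ℓ (Pi.single (.inr (i - 1)) 1) * α i) (e₃ := 0)
      hI hIJ hn fun x => by
        have := h _ (cyclicMap_mem α I J (Pi.single i x))
        rw [apply_cyclicMap_single] at this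
        linear_combination this
    exact ⟨h0, h1⟩
  exact eq_zero_of_apply_single_eq_zero (fun i => (key i).1) fun i => (key i).2

/-- A linear form vanishing on the part of the cyclic system in the kernel of another linear form
is a multiple of the latter. -/
theorem exists_eq_smul_of_vanishing_on_inter_ker (hα : ∀ i, α i ≠ 0) (hI : 1 ≤ I) (hIJ : I < J)
    (hn : 2 * J + 1 ≤ Module.finrank F L) {i₁ i₂ : ZMod m}
    (hpow : ¬ ∃ β : L, β ^ (Nat.card F ^ (m * (J - I)) - 1) =
      cyclicProd (Nat.card F) (J - I) α i₁ / cyclicProd (Nat.card F) (J - I) α i₂)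
    {ℓ ℓ' : (ZMod m ⊕ ZMod m → L) →ₗ[L] L}
    (h : ∀ w ∈ cyclicSystem F α I J, ℓ w = 0 → ℓ' w = 0) : ∃ c : L, ℓ' = c • ℓ := by
  by_cases hℓ : ℓ = 0
  · refine ⟨0, ?_⟩
    rw [zero_smul]
    exact eq_zero_of_vanishing_on_cyclicSystem hI hIJ hn fun w hw => h w hw (by simp [hℓ])
  by_contra hnot
  obtain ⟨ψ, hψ⟩ := exists_comp_eq_of_ker_le_ker
    (f := ℓ.restrictScalars F ∘ₗ cyclicMap F α I J)
    (g := ℓ'.restrictScalars F ∘ₗ cyclicMap F α I J)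
    fun x hx => h _ (cyclicMap_mem α I J x) hx
  obtain ⟨u, hu⟩ := exists_trace_adjoint ψ
  -- Joint injectivity is automatic because `v = -id`.
  refine false_of_frobenius_system (m := m) (J := J) (K := J - I) (u := u) (v := -LinearMap.id)
    (a := fun i => ℓ (Pi.single (.inl i) 1)) (a' := fun i => ℓ' (Pi.single (.inl i) 1))
    (b := fun i => ℓ (Pi.single (.inr i) 1)) (b' := fun i => ℓ' (Pi.single (.inr i) 1))
    hα (by omega) (by omega) hpow hn (fun s _ hs => by simpa using hs) (fun i s => ?_) ?_
  · refine (traceForm_nondegenerate F L).1 _ fun y => ?_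
    -- Testing against `x^(q^J)` lets trace invariance undo the powers `q^J` and `q^(J-I)`,
    -- recovering the terms in `x` and `x^(q^I)`.
    obtain ⟨x, rfl⟩ := (frobPow F J).surjective y
    have h1 := hu s (ℓ (cyclicMap F α I J (Pi.single i x)))
    have h2 : ψ (ℓ (cyclicMap F α I J (Pi.single i x))) = ℓ' (cyclicMap F α I J (Pi.single i x)) :=
      hψ (Pi.single i x)
    rw [h2, ← sub_eq_zero, ← map_sub, apply_cyclicMap_single, apply_cyclicMap_single] at h1
    have hIJ' : frobPow F J x = frobPow F (J - I) (frobPow F I x) := by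
      rw [frobPow_frobPow, Nat.sub_add_cancel hIJ.le]
    rw [Algebra.traceForm_apply, add_mul, add_mul, map_add, map_add, ← map_mul, trace_frobPow,
      hIJ', ← map_mul, trace_frobPow, ← hIJ', ← map_add, ← map_add, ← h1]
    congr 1
    simp only [LinearMap.neg_apply, LinearMap.id_apply]
    ring
  · intro s t hs ht
    have hst : s • ℓ + t • ℓ' = 0 := eq_zero_of_apply_single_eq_zero hs ht
    have ht0 : t = 0 := by
      by_contra ht0
      refine hnot ⟨-(t⁻¹ * s), ?_⟩
      refine LinearMap.ext fun w => mul_left_cancel₀ ht0 ?_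
      have : s * ℓ w + t * ℓ' w = 0 := LinearMap.congr_fun hst w
      rw [LinearMap.smul_apply, smul_eq_mul]
      field_simp
      linear_combination this
    rw [ht0, zero_smul, add_zero] at hst
    exact ⟨(smul_eq_zero.1 hst).resolve_right hℓ, ht0⟩

end CyclicSystem

/-! ### Cutting blocking sets and minimal codes via linear forms. -/

section CuttingBlockingSets

variable {F L V : Type*} [Field F] [Field L] [Algebra F L] [AddCommGroup V]
  [Module F V] [Module L V] [IsScalarTower F L V]

theorem isLinearCutting_of_exists_eq_smul [FiniteDimensional L V] {U : Submodule F V}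
    (hspan : ∀ ℓ : V →ₗ[L] L, (∀ w ∈ U, ℓ w = 0) → ℓ = 0)
    (h : ∀ ℓ ℓ' : V →ₗ[L] L, (∀ w ∈ U, ℓ w = 0 → ℓ' w = 0) → ∃ c : L, ℓ' = c • ℓ) :
    IsLinearCutting (L := L) U := by
  refine ⟨?_, fun H hH => ?_⟩
  · by_contra hne
    obtain ⟨f, hf, hle⟩ := Submodule.exists_le_ker_of_lt_top _ (lt_top_iff_ne_top.2 hne)
    exact hf (hspan f fun w hw => hle (Submodule.subset_span hw))
  · have hlt : H < ⊤ := by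
      refine lt_top_iff_ne_top.2 ?_
      rintro rfl
      rw [finrank_top] at hH
      omega
    obtain ⟨ℓ, hℓ, hle⟩ := Submodule.exists_le_ker_of_lt_top _ hlt
    have hker : H = LinearMap.ker ℓ := by
      refine Submodule.eq_of_le_of_finrank_eq hle ?_
      have := Module.Dual.finrank_ker_add_one_of_ne_zero hℓ
      omega
    refine le_antisymm (Submodule.span_le.2 Set.inter_subset_right) fun x hx => ?_
    by_contra hnot
    obtain ⟨f, hfx, hf⟩ := Submodule.exists_le_ker_of_notMem hnot
    obtain ⟨c, rfl⟩ := h ℓ f fun w hw hℓw =>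
      hf (Submodule.subset_span ⟨hw, hker ▸ LinearMap.mem_ker.2 hℓw⟩)
    refine hfx ?_
    rw [LinearMap.smul_apply, LinearMap.mem_ker.1 (hle hx), smul_zero]

theorem exists_apply_eq_of_mem_associatedCode {κ : Type*} {N : ℕ} {U : Submodule F (κ → L)}
    {B : Module.Basis (Fin N) F U} {c : Fin N → L} (hc : c ∈ associatedCode B) :
    ∃ ℓ : (κ → L) →ₗ[L] L, ∀ j, c j = ℓ (B j) := by
  have hle : associatedCode B ≤ LinearMap.range
      (LinearMap.pi fun j => LinearMap.applyₗ (B j : κ → L) :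
        Module.Dual L (κ → L) →ₗ[L] (Fin N → L)) := by
    refine Submodule.span_le.2 ?_
    rintro _ ⟨i, rfl⟩
    exact ⟨LinearMap.proj i, rfl⟩
  obtain ⟨ℓ, rfl⟩ := hle hc
  exact ⟨ℓ, fun j => rfl⟩

/-- The `F`-relations among the entries of a word are exactly the vectors orthogonal to its rank
support, so a smaller support satisfies more relations. -/
theorem sum_smul_eq_zero_of_rankSupport_le {N : ℕ} {c c' : Fin N → L}
    (h : rankSupport F c' ≤ rankSupport F c) {x : Fin N → F} (hx : ∑ j, x j • c j = 0) :
    ∑ j, x j • c' j = 0 := by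
  refine (Module.forall_dual_apply_eq_zero_iff F _).1 fun φ => ?_
  obtain ⟨φ', hφ'⟩ := h ⟨φ, rfl⟩
  have hφ : ∀ j, φ' (c j) = φ (c' j) := congr_fun hφ'
  simpa [hφ] using congr_arg φ' hx

theorem isMinimalRankCode_of_exists_eq_smul {κ : Type*} {N : ℕ} {U : Submodule F (κ → L)}
    (h : ∀ ℓ ℓ' : (κ → L) →ₗ[L] L, (∀ w ∈ U, ℓ w = 0 → ℓ' w = 0) → ∃ c : L, ℓ' = c • ℓ)
    (B : Module.Basis (Fin N) F U) : IsMinimalRankCode F (associatedCode B) := by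
  intro c hc c' hc' hle
  obtain ⟨ℓ, hℓ⟩ := exists_apply_eq_of_mem_associatedCode hc
  obtain ⟨ℓ', hℓ'⟩ := exists_apply_eq_of_mem_associatedCode hc'
  have hsum : ∀ (f : (κ → L) →ₗ[L] L) (w : U), f w = ∑ j, B.repr w j • f (B j) := by
    intro f w
    conv_lhs => rw [← B.sum_repr w]
    simp only [Submodule.coe_sum, Submodule.coe_smul, map_sum, f.map_smul_of_tower]
  obtain ⟨a, rfl⟩ := h ℓ ℓ' fun w hw hw0 => by
    rw [hsum ℓ ⟨w, hw⟩] at hw0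
    rw [hsum ℓ' ⟨w, hw⟩]
    simp only [← hℓ, ← hℓ'] at hw0 ⊢
    exact sum_smul_eq_zero_of_rankSupport_le hle hw0
  refine ⟨a, funext fun j => ?_⟩
  rw [hℓ', Pi.smul_apply, hℓ, LinearMap.smul_apply]

end CuttingBlockingSets

theorem mainTheorem8 {F L : Type*} [Field F] [Finite F] [Field L] [Finite L] [Algebra F L]
    (q n m I J : ℕ) (hq : Nat.card F = q) (hn : Module.finrank F L = n) (hm : 3 ≤ m)
    (hI : 1 ≤ I) (hIJ : I < J) (hJn : 2 * J + 1 ≤ n)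
    (α : ZMod m → L) (hα : ∀ i, α i ≠ 0)
    (hpow : ∃ δ ∈ Finset.Icc 1 (m - 1), ¬ ∃ β : L, β ^ (q ^ (m * (J - I)) - 1) =
      cyclicProd q (J - I) α ((δ : ZMod m) + 2) / cyclicProd q (J - I) α 2) :
    Module.finrank F (cyclicSystem F α I J) = m * n ∧
    IsLinearCutting (L := L) (cyclicSystem F α I J) ∧
    ∀ B : Module.Basis (Fin (m * n)) F (cyclicSystem F α I J),
      IsMinimalRankCode F (associatedCode B) := by
  subst hq hn
  have : NeZero m := ⟨by omega⟩
  obtain ⟨δ, -, hδ⟩ := hpow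
  have key : ∀ ℓ ℓ' : (ZMod m ⊕ ZMod m → L) →ₗ[L] L,
      (∀ w ∈ cyclicSystem F α I J, ℓ w = 0 → ℓ' w = 0) → ∃ c : L, ℓ' = c • ℓ :=
    fun _ _ => exists_eq_smul_of_vanishing_on_inter_ker hα hI hIJ hJn hδ
  exact ⟨finrank_cyclicSystem α I J, isLinearCutting_of_exists_eq_smul
    (fun _ => eq_zero_of_vanishing_on_cyclicSystem hI hIJ hJn) key,
    isMinimalRankCode_of_exists_eq_smul key⟩
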